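/- Let $\omega=\{0,1,2,\dots\}$. An (admissible) ideal on a countably infinite set $Z$ is a family $\mathcal I\subseteq\mathcal P(Z)$ closed under subsets and finite unions, containing all finite sets, with $Z\notin\mathcal I$; it is regarded as a subset of the Cantor space $\{0,1\}^Z$ through characteristic functions, and it is called a $\Gamma$-ideal if it belongs to the pointclass $\Gamma$ there. For families $\mathcal I\subseteq\mathcal P(Z)$ and $\mathcal J\subseteq\mathcal P(W)$ let $$\mathcal I\times\mathcal J=\{S\subseteq Z\times W:\ \{n\in Z:\{k\in W:(n,k)\in S\}\notin\mathcal J\}\in\mathcal I\}.$$ Let $\mathrm{Fin}^1=\mathrm{Fin}$ be the ideal of finite subsets of $\omega$, let $\mathrm{Fin}^{\alpha}=\mathrm{Fin}\times\mathrm{Fin}^{\alpha-1}$ on $\omega^\alpha=\omega\times\omega^{\alpha-1}$ for integers $\alpha\ge 2$, and let $\emptyset\times\mathrm{Fin}^\alpha$ denote $\{\emptyset\}\times\mathrm{Fin}^\alpha$ on $\omega\times\omega^{\alpha}$, where $\{\emptyset\}\subseteq\mathcal P(\omega)$. For a topological space $X$, an ideal $\mathcal I$ on $Z$ and $x\in X^Z$,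 let $\Lambda_x(\mathcal I)$ be the set of all $\eta\in X$ for which there is an (infinite) set $S\subseteq Z$ with $S\notin\mathcal I$ such that the subsequence $(x_z)_{z\in S}$ converges to $\eta$, i.e. every neighbourhood of $\eta$ contains $x_z$ for all but finitely many $z\in S$. Put $$\mathscr L_X(\mathcal I)=\{\Lambda_x(\mathcal I):x\in X^Z\}\cup\{\emptyset\}.$$ **Theorem.** Let $X$ be a separable completely metrizable (i.e. Polish) space. Then for every integer $\alpha\ge 1$: 1. $\mathrm{Fin}^\alpha$ is a $\Sigma^0_{2\alpha}$-ideal and $\mathscr L_X(\mathrm{Fin}^\alpha)=\Pi^0_{2\alpha-1}(X)$; 2. $\emptyset\times\mathrm{Fin}^\alpha$ is a $\Pi^0_{2\alpha+1}$-ideal and $\mathscr L_X(\emptyset\times\mathrm{Fin}^\alpha)=\Sigma^0_{2\alpha}(X)$. In particular the families $\mathscr L_X(\mathcal I)$ reach arbitrarily high finite Borel levels: if $X$ is uncountable, then for every integer $n\ge1$ there is $\alpha\ge1$ such that each of $\mathscr L_X(\mathrm{Fin}^\alpha)$ and $\mathscr L_X(\emptyset\times\mathrm{Fin}^\alpha)$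 contains a set that is neither $\Sigma^0_n$ nor $\Pi^0_n$ in $X$. -/

import Mathlib

open Set Filter Topology

/-- The finite additive Borel class `Σ⁰ₙ(X)`, `n ≥ 1`: `Σ⁰₁` is the family of open sets, and `Σ⁰ₙ₊₁`
is the family of countable unions of complements of `Σ⁰ₙ` sets, i.e. of `Π⁰ₙ` sets.
(The value at `n = 0` is a placeholder.) -/
def SigmaZero (X : Type*) [TopologicalSpace X] : ℕ → Set (Set X)
  | 0 => ∅
  | 1 => {A | IsOpen A}
  | n + 2 => {A | ∃ B : ℕ → Set X, (∀ i, (B i)ᶜ ∈ SigmaZero X (n + 1)) ∧ A = ⋃ i, B i}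

/-- The finite multiplicative Borel class `Π⁰ₙ(X)`, `n ≥ 1`: complements of `Σ⁰ₙ` sets. -/
def PiZero (X : Type*) [TopologicalSpace X] (n : ℕ) : Set (Set X) :=
  {A | Aᶜ ∈ SigmaZero X n}

/-- `I` is an admissible ideal on the set `Z`: a family of subsets of `Z` closed under subsets and
finite unions, containing all finite sets and not containing `Z`. -/
structure IsAdmissibleIdeal {Z : Type*} (I : Set (Set Z)) : Prop where
  subset_mem : ∀ S T : Set Z, S ⊆ T → T ∈ I → S ∈ I
  union_mem : ∀ S T : Set Z, S ∈ I → T ∈ I → S ∪ T ∈ I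
  finite_mem : ∀ S : Set Z, S.Finite → S ∈ I
  univ_notMem : (univ : Set Z) ∉ I

/-- A family of subsets of `Z`, regarded as a subset of the product space `{0,1}^Z` by identifying
sets with their characteristic functions. -/
def asCantorSubset {Z : Type*} (I : Set (Set Z)) : Set (Z → Bool) :=
  {χ | {z | χ z = true} ∈ I}

/-- The ideal `Fin` of finite subsets of `Z`. -/
def finIdeal (Z : Type*) : Set (Set Z) := {S | S.Finite}

/-- The Fubini product `I × J`. -/
def fubiniProd {Z W : Type*} (I : Set (Set Z)) (J : Set (Set W)) : Set (Set (Z × W)) :=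
  {S | {n | {k | (n, k) ∈ S} ∉ J} ∈ I}

/-- The underlying set `ω^α`: `ω¹ = ω` and `ω^(α+1) = ω × ω^α` for `α ≥ 1`.
(Only `α ≥ 1` is used.) -/
abbrev OmegaPow : ℕ → Type
  | 0 => Unit
  | 1 => ℕ
  | n + 2 => ℕ × OmegaPow (n + 1)

/-- The ideal `Fin^α` on `ω^α`: `Fin¹ = Fin` and `Fin^(α+1) = Fin × Fin^α` for `α ≥ 1`.
(Only `α ≥ 1` is used.) -/
def finPow : (α : ℕ) → Set (Set (OmegaPow α))
  | 0 => {∅}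
  | 1 => finIdeal ℕ
  | n + 2 => fubiniProd (finIdeal ℕ) (finPow (n + 1))

/-- The ideal `∅ × Fin^α` on `ω × ω^α`: the Fubini product of the (nonadmissible) ideal `{∅}` on `ω`
with `Fin^α`. -/
def emptyTimesFinPow (α : ℕ) : Set (Set (ℕ × OmegaPow α)) :=
  fubiniProd ({∅} : Set (Set ℕ)) (finPow α)

/-- The set of `I`-limit points of a `Z`-indexed sequence `x` (with `Z` countable): the points `η`
such that the subsequence `(x z : z ∈ S)` converges to `η` for some infinite `S ∉ I`. Convergence
means that every neighbourhood of `η` contains `x z` for all but finitely many `z ∈ S`; it does not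
depend on the enumeration of `S`. -/
def idealLimitPoints {X Z : Type*} [TopologicalSpace X] (I : Set (Set Z)) (x : Z → X) : Set X :=
  {η | ∃ S : Set Z, S.Infinite ∧ S ∉ I ∧ Tendsto x (cofinite ⊓ 𝓟 S) (𝓝 η)}

/-- The family `ℒ_X(I)` of sets of `I`-limit points of sequences in `X`, together with the empty
set. -/
def limitFamily (X : Type*) [TopologicalSpace X] {Z : Type*} (I : Set (Set Z)) : Set (Set X) :=
  {A | ∃ x : Z → X, A = idealLimitPoints I x} ∪ {∅}

/-!
The argument rests on a recursion for limit points. A point `η` is a limit point of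
`x : ω × W → X` along `Fin × J` exactly when it is a limit point along `J` of infinitely many of the
sections `x (n, ·)`, and along `∅ × J` exactly when it is one for some section
(`idealLimitPoints_fin_fubiniProd`, `idealLimitPoints_empty_fubiniProd`). Limit points along `Fin`
are the ordinary cluster points, which form a closed set, and any nonempty closed set of a separable
metrizable space arises in this way (`exists_idealLimitPoints_finIdeal_eq`). By induction the
sets of limit points along `Fin^α` are `Π⁰` of level `2α - 1`.

The converse is a statement about Borel classes only: every nonempty `Π⁰ₙ₊₂` set with `n ≥ 1` is
the set of points lying in infinitely many members of a sequence of nonempty `Π⁰ₙ` sets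
(`exists_limsup_of_mem_piZero`). Write it as a decreasing intersection of `Σ⁰ₙ₊₁` sets and each of
these as a *point-finite* union of `Π⁰ₙ` sets; then infinitely many pieces contain a given point iff
it lies in infinitely many, hence all, of the `Σ⁰ₙ₊₁` sets. Point-finite decompositions
(`exists_pointFinite_succ`, `exists_pointFinite_of_mem_sigmaZero`) take the place of
disjoint ones, which do not exist at the lowest level: an open interval is not a countable union of
disjoint sets closed in the line. Nonemptiness is kept track of because in a compact space every
sequence has a cluster point, so that the empty set need not be a set of limit points.

The complexity of the ideals follows by the same recursion, `Fin × J` being described by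
`∃ i, ∀ k ≥ i`. Finally, the Borel classes of an uncountable Polish space are distinct: universal
sets and diagonalization give this in the Cantor space, which embeds as a closed subspace
(`exists_piZero_notMem_sigmaZero`).
-/

/-! ### The finite Borel classes -/

section BorelClasses

variable {X Y : Type*} [TopologicalSpace X] [TopologicalSpace Y]

theorem compl_mem_piZero {n : ℕ} {A : Set X} : Aᶜ ∈ PiZero X n ↔ A ∈ SigmaZero X n := by
  simp [PiZero]

theorem mem_sigmaZero_one {A : Set X} : A ∈ SigmaZero X 1 ↔ IsOpen A := Iff.rfl

theorem mem_piZero_one {A : Set X} : A ∈ PiZero X 1 ↔ IsClosed A := isOpen_compl_iff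

theorem sigmaZero_iUnion {n : ℕ} {A : ℕ → Set X} (hA : ∀ i, A i ∈ SigmaZero X (n + 1)) :
    (⋃ i, A i) ∈ SigmaZero X (n + 1) := by
  cases n with
  | zero => exact isOpen_iUnion hA
  | succ n =>
    choose B hB hAB using hA
    refine ⟨fun m => B m.unpair.1 m.unpair.2, fun m => hB _ _, ?_⟩
    ext x
    simp only [hAB, mem_iUnion]
    constructor
    · rintro ⟨i, j, h⟩
      exact ⟨Nat.pair i j, by simpa using h⟩
    · rintro ⟨m, h⟩
      exact ⟨_, _, h⟩

theorem piZero_iInter {n : ℕ} {A : ℕ → Set X} (hA : ∀ i, A i ∈ PiZero X (n + 1)) :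
    (⋂ i, A i) ∈ PiZero X (n + 1) := by
  rw [PiZero, mem_ofPred_eq, compl_iInter]
  exact sigmaZero_iUnion hA

theorem sigmaZero_preimage {n : ℕ} {f : X → Y} (hf : Continuous f) {A : Set Y}
    (hA : A ∈ SigmaZero Y n) : f ⁻¹' A ∈ SigmaZero X n := by
  induction n using Nat.strong_induction_on generalizing A with
  | _ n ih =>
    match n, hA with
    | 1, hA => exact IsOpen.preimage hf hA
    | n + 2, ⟨B, hB, hAB⟩ =>
      refine ⟨fun i => f ⁻¹' B i, fun i => ih (n + 1) (by omega) (hB i), ?_⟩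
      rw [hAB, preimage_iUnion]

theorem piZero_preimage {n : ℕ} {f : X → Y} (hf : Continuous f) {A : Set Y}
    (hA : A ∈ PiZero Y n) : f ⁻¹' A ∈ PiZero X n :=
  sigmaZero_preimage hf hA

theorem piZero_subset_sigmaZero_succ {n : ℕ} : PiZero X (n + 1) ⊆ SigmaZero X (n + 2) :=
  fun A hA => ⟨fun _ => A, fun _ => hA, (iUnion_const A).symm⟩

theorem sigmaZero_subset_piZero_succ {n : ℕ} : SigmaZero X (n + 1) ⊆ PiZero X (n + 2) :=
  fun _ hA => piZero_subset_sigmaZero_succ (compl_mem_piZero.2 hA)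

/-- Intersections and unions are treated together: the intersection of two `Σ⁰ₙ₊₂` sets is
reduced to the union of two `Σ⁰ₙ₊₁` sets. -/
theorem sigmaZero_inter_union {n : ℕ} {A B : Set X} (hA : A ∈ SigmaZero X (n + 1))
    (hB : B ∈ SigmaZero X (n + 1)) :
    A ∩ B ∈ SigmaZero X (n + 1) ∧ A ∪ B ∈ SigmaZero X (n + 1) := by
  induction n generalizing A B with
  | zero => exact ⟨IsOpen.inter hA hB, IsOpen.union hA hB⟩
  | succ n ih =>
    constructor
    · obtain ⟨C, hC, rfl⟩ := hA
      obtain ⟨D, hD, rfl⟩ := hB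
      refine ⟨fun m => C m.unpair.1 ∩ D m.unpair.2, fun m => ?_, ?_⟩
      · rw [compl_inter]
        exact (ih (hC _) (hD _)).2
      · ext x
        simp only [mem_iUnion, mem_inter_iff]
        constructor
        · rintro ⟨⟨i, h⟩, j, h'⟩
          exact ⟨Nat.pair i j, by simpa using ⟨h, h'⟩⟩
        · rintro ⟨m, h, h'⟩
          exact ⟨⟨_, h⟩, _, h'⟩
    · have h : ∀ i : ℕ, (if i = 0 then A else B) ∈ SigmaZero X (n + 2) := fun i => by
        split_ifs <;> assumption
      convert sigmaZero_iUnion h using 1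
      ext x
      simp only [mem_union, mem_iUnion]
      constructor
      · rintro (h | h)
        · exact ⟨0, by simpa using h⟩
        · exact ⟨1, by simpa using h⟩
      · rintro ⟨i, h⟩
        split_ifs at h
        · exact Or.inl h
        · exact Or.inr h

theorem sigmaZero_inter {n : ℕ} {A B : Set X} (hA : A ∈ SigmaZero X (n + 1))
    (hB : B ∈ SigmaZero X (n + 1)) : A ∩ B ∈ SigmaZero X (n + 1) :=
  (sigmaZero_inter_union hA hB).1

theorem piZero_inter {n : ℕ} {A B : Set X} (hA : A ∈ PiZero X (n + 1))
    (hB : B ∈ PiZero X (n + 1)) : A ∩ B ∈ PiZero X (n + 1) := by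
  rw [PiZero, mem_ofPred_eq, compl_inter]
  exact (sigmaZero_inter_union hA hB).2

theorem sigmaZero_biInter_lt {n : ℕ} {A : ℕ → Set X} (hA : ∀ i, A i ∈ SigmaZero X (n + 1))
    (k : ℕ) : (⋂ i, ⋂ (_ : i < k), A i) ∈ SigmaZero X (n + 1) := by
  induction k with
  | zero =>
    simp only [not_lt_zero, iInter_of_empty, iInter_univ]
    clear hA
    -- the whole space lies in every class `Σ⁰ₙ₊₁` and in every class `Π⁰ₙ₊₁`
    suffices h : (univ : Set X) ∈ SigmaZero X (n + 1) ∧ (univ : Set X) ∈ PiZero X (n + 1) from h.1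
    induction n with
    | zero => exact ⟨isOpen_univ, mem_piZero_one.2 isClosed_univ⟩
    | succ n ih => exact ⟨piZero_subset_sigmaZero_succ ih.2, sigmaZero_subset_piZero_succ ih.1⟩
  | succ k ih =>
    rw [biInter_lt_succ]
    exact sigmaZero_inter ih (hA k)

end BorelClasses

/-! ### Point-finite decompositions -/

section PointFinite

variable {X : Type*} [TopologicalSpace X]

/-- An open subset of a metrizable space is a point-finite union of closed sets: if the set is
`{f > 0}` with `f` continuous, take the shells `{j ≤ 1 / f ≤ j + 1}`. -/
theorem IsOpen.exists_pointFinite_isClosed [TopologicalSpace.MetrizableSpace X] {U : Set X}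
    (hU : IsOpen U) : ∃ B : ℕ → Set X, (∀ j, IsClosed (B j)) ∧ U = ⋃ j, B j ∧
      ∀ x, {j | x ∈ B j}.Finite := by
  obtain ⟨f, hf, hfU⟩ : ∃ f : X → ℝ, Continuous f ∧ ∀ x, 0 < f x ↔ x ∈ U := by
    let := TopologicalSpace.metrizableSpaceMetric X
    by_cases hne : (Uᶜ).Nonempty
    · exact ⟨fun x => Metric.infDist x Uᶜ, Metric.continuous_infDist_pt _, fun x => by
        rw [← hU.isClosed_compl.notMem_iff_infDist_pos hne, notMem_compl_iff]⟩
    · rw [not_nonempty_iff_eq_empty, compl_empty_iff] at hne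
      exact ⟨fun _ => 1, continuous_const, fun x => by simp [hne]⟩
  refine ⟨fun j => {x | 1 ≤ (j + 1 : ℝ) * f x} ∩ {x | (j : ℝ) * f x ≤ 1}, fun j => ?_, ?_,
    fun x => ?_⟩
  · exact (isClosed_le continuous_const (continuous_const.mul hf)).inter
      (isClosed_le (continuous_const.mul hf) continuous_const)
  · ext x
    rw [← hfU, mem_iUnion]
    constructor
    · intro hx
      refine ⟨⌊1 / f x⌋₊, ?_, ?_⟩
      · have := (Nat.lt_floor_add_one (1 / f x)).le
        rwa [div_le_iff₀ hx] at this
      · have := Nat.floor_le (one_div_pos.2 hx).le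
        rwa [le_div_iff₀ hx] at this
    · rintro ⟨j, hj, -⟩
      by_contra hneg
      have hj : 1 ≤ (j + 1 : ℝ) * f x := hj
      nlinarith [mul_nonneg (by positivity : (0 : ℝ) ≤ j + 1) (neg_nonneg.2 (not_lt.1 hneg))]
  · by_cases hx : 0 < f x
    · refine (finite_Iic ⌊1 / f x⌋₊).subset fun j hj => ?_
      have hj : (j : ℝ) * f x ≤ 1 := hj.2
      exact Nat.le_floor (by rwa [le_div_iff₀ hx])
    · convert finite_empty
      ext j
      simp only [mem_ofPred_eq, mem_empty_iff_false, iff_false]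
      rintro ⟨hj, -⟩
      have hj : 1 ≤ (j + 1 : ℝ) * f x := hj
      nlinarith [mul_nonneg (by positivity : (0 : ℝ) ≤ j + 1) (neg_nonneg.2 (not_lt.1 hx))]

/-- The step of the induction in `exists_pointFinite_of_mem_sigmaZero`: write the set as a
union of `Π⁰` sets `F i`, and split each difference `F i \ ⋃ j < i, F j` using the
point-finite decomposition of the complement of `⋃ j < i, F j`. -/
theorem exists_pointFinite_succ {n : ℕ}
    (H : ∀ A ∈ SigmaZero X (n + 1), ∃ B : ℕ → Set X, (∀ j, B j ∈ PiZero X (n + 1)) ∧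
      A = ⋃ j, B j ∧ ∀ x, {j | x ∈ B j}.Finite)
    {A : Set X} (hA : A ∈ SigmaZero X (n + 2)) :
    ∃ B : ℕ → Set X, (∀ j, B j ∈ PiZero X (n + 1)) ∧ A = ⋃ j, B j ∧
      ∀ x, {j | x ∈ B j}.Finite := by
  obtain ⟨F, hF, rfl⟩ := hA
  choose C hC hCU hCfin using fun i => H _ (sigmaZero_biInter_lt hF i)
  have hlt : ∀ i j x, x ∈ C i j → ∀ k < i, x ∉ F k := by
    intro i j x hx k hk
    have : x ∈ ⋂ k, ⋂ (_ : k < i), (F k)ᶜ := by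
      rw [hCU]
      exact mem_iUnion_of_mem j hx
    simp only [mem_iInter] at this
    exact this k hk
  refine ⟨fun m => F m.unpair.1 ∩ C m.unpair.1 m.unpair.2, fun m => piZero_inter (hF _) (hC _ _),
    ?_, fun x => ?_⟩
  · ext x
    simp only [mem_iUnion]
    constructor
    · intro hx
      classical
      have hmin : x ∈ ⋂ k, ⋂ (_ : k < Nat.find hx), (F k)ᶜ := by
        simp only [mem_iInter]
        exact fun k hk => Nat.find_min hx hk
      rw [hCU] at hmin
      obtain ⟨j, hj⟩ := mem_iUnion.1 hmin
      exact ⟨Nat.pair (Nat.find hx) j, by simpa using ⟨Nat.find_spec hx, hj⟩⟩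
    · rintro ⟨m, hm, -⟩
      exact ⟨_, hm⟩
  · by_cases hx : ∃ i, x ∈ F i
    · obtain ⟨i₀, hi₀⟩ := hx
      refine ((finite_Iic i₀).biUnion fun i _ => (hCfin i x).image (Nat.pair i)).subset ?_
      rintro m ⟨-, hm⟩
      refine mem_biUnion (x := m.unpair.1) ?_ ⟨m.unpair.2, hm, Nat.pair_unpair m⟩
      by_contra h
      exact hlt _ _ _ hm i₀ (not_le.1 h) hi₀
    · convert finite_empty
      ext m
      simp only [mem_ofPred_eq, mem_empty_iff_false, iff_false]
      exact fun hm => hx ⟨_, hm.1⟩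

/-- Monotonicity of the classes is proved along with the decompositions: it is what turns the
`Π⁰ₙ₊₁` pieces given by `exists_pointFinite_succ` into `Π⁰ₙ₊₂` pieces. -/
theorem exists_pointFinite_of_mem_sigmaZero [TopologicalSpace.MetrizableSpace X] (n : ℕ) :
    SigmaZero X (n + 1) ⊆ SigmaZero X (n + 2) ∧
    ∀ A ∈ SigmaZero X (n + 1), ∃ B : ℕ → Set X, (∀ j, B j ∈ PiZero X (n + 1)) ∧
      A = ⋃ j, B j ∧ ∀ x, {j | x ∈ B j}.Finite := by
  induction n with
  | zero =>
    have H : ∀ A ∈ SigmaZero X 1, ∃ B : ℕ → Set X, (∀ j, B j ∈ PiZero X 1) ∧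
        A = ⋃ j, B j ∧ ∀ x, {j | x ∈ B j}.Finite := fun A hA => by
      simpa only [mem_piZero_one] using IsOpen.exists_pointFinite_isClosed hA
    refine ⟨fun A hA => ?_, H⟩
    obtain ⟨B, hB, h, -⟩ := H A hA
    exact ⟨B, hB, h⟩
  | succ n ih =>
    have hP : PiZero X (n + 1) ⊆ PiZero X (n + 2) := fun A hA => ih.1 hA
    refine ⟨?_, fun A hA => ?_⟩
    · rintro A ⟨B, hB, h⟩
      exact ⟨B, fun i => hP (hB i), h⟩
    · obtain ⟨B, hB, h⟩ := exists_pointFinite_succ ih.2 hA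
      exact ⟨B, fun i => hP (hB i), h⟩

theorem sigmaZero_mono [TopologicalSpace.MetrizableSpace X] {m n : ℕ} (hm : 1 ≤ m)
    (h : m ≤ n) : SigmaZero X m ⊆ SigmaZero X n := by
  induction n, h using Nat.le_induction with
  | base => exact Subset.rfl
  | succ n hn ih =>
    obtain ⟨k, rfl⟩ : ∃ k, n = k + 1 := ⟨n - 1, by omega⟩
    exact ih.trans (exists_pointFinite_of_mem_sigmaZero k).1

/-- Lying in infinitely many members of a sequence of `Π⁰ₙ₊₁` sets is a `Π⁰ₙ₊₃` condition. -/
theorem limsup_mem_piZero {n : ℕ} {C : ℕ → Set X} (hC : ∀ i, C i ∈ PiZero X (n + 1)) :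
    {x | {i | x ∈ C i}.Infinite} ∈ PiZero X (n + 3) := by
  have h : {x | {i | x ∈ C i}.Infinite} = ⋂ k : ℕ, ⋃ i : ℕ, C (i + k) := by
    ext x
    simp only [mem_ofPred_eq, mem_iInter, mem_iUnion]
    rw [← Nat.frequently_atTop_iff_infinite, frequently_atTop]
    refine forall_congr' fun k => ⟨?_, ?_⟩
    · rintro ⟨i, hi, hx⟩
      exact ⟨i - k, by rwa [Nat.sub_add_cancel hi]⟩
    · rintro ⟨i, hx⟩
      exact ⟨i + k, Nat.le_add_left _ _, hx⟩
  rw [h]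
  refine piZero_iInter fun k => sigmaZero_subset_piZero_succ ?_
  exact ⟨fun i => C (i + k), fun i => hC _, rfl⟩

/-- A nonempty `Π⁰ₙ₊₃` set consists of the points lying in infinitely many members of a suitable
sequence of nonempty `Π⁰ₙ₊₁` sets. Write it as a decreasing intersection of `Σ⁰ₙ₊₂` sets and
decompose each of these in a point-finite way: a point lies in infinitely many pieces exactly when
it lies in all the `Σ⁰ₙ₊₂` sets. -/
theorem exists_limsup_of_mem_piZero [TopologicalSpace.MetrizableSpace X] {n : ℕ} {A : Set X}
    (hA : A ∈ PiZero X (n + 3)) (hne : A.Nonempty) :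
    ∃ C : ℕ → Set X, (∀ i, C i ∈ PiZero X (n + 1)) ∧ (∀ i, (C i).Nonempty) ∧
      A = {x | {i | x ∈ C i}.Infinite} := by
  obtain ⟨D, hD, hAD⟩ := hA
  have hAD : A = ⋂ i, (D i)ᶜ := by rw [← compl_iUnion, ← hAD, compl_compl]
  choose F hF hFU hFfin using fun i => exists_pointFinite_succ
    (exists_pointFinite_of_mem_sigmaZero n).2 (sigmaZero_biInter_lt hD i)
  have hmem : ∀ x i, (∃ j, x ∈ F i j) ↔ ∀ k < i, x ∉ D k := by
    intro x i
    rw [← mem_iUnion, ← hFU]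
    simp
  let G : ℕ → Set X := fun m => F m.unpair.1 m.unpair.2
  have hG : A = {x | {m | x ∈ G m}.Infinite} := by
    ext x
    rw [hAD, mem_iInter]
    constructor
    · intro hx
      choose j hj using fun i => (hmem x i).2 fun k _ => hx k
      refine infinite_of_injective_forall_mem (f := fun i => Nat.pair i (j i)) ?_ fun i => ?_
      · intro i i' h
        exact (Nat.pair_eq_pair.1 h).1
      · simpa [G] using hj i
    · intro hx k hk
      refine hx (((finite_Iic k).biUnion fun i _ => (hFfin i x).image (Nat.pair i)).subset ?_)
      intro m hm
      refine mem_biUnion (x := m.unpair.1) ?_ ⟨m.unpair.2, hm, Nat.pair_unpair m⟩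
      by_contra h
      exact (hmem x _).1 ⟨_, hm⟩ k (not_le.1 h) hk
  -- discard the empty pieces; infinitely many remain since `A` has a point
  obtain ⟨a, ha⟩ := hne
  have hinf : {m | (G m).Nonempty}.Infinite := by
    rw [hG] at ha
    exact Infinite.mono (fun m hm => ⟨a, hm⟩) ha
  have := hinf.to_subtype
  obtain ⟨e⟩ : Nonempty (ℕ ≃ {m | (G m).Nonempty}) := nonempty_equiv_of_countable
  refine ⟨fun i => G (e i), fun i => hF _ _, fun i => (e i).2, ?_⟩
  rw [hG]
  ext x
  have himage : {m | x ∈ G m} = (fun i => (e i : ℕ)) '' {i | x ∈ G (e i)} := by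
    ext m
    constructor
    · intro hm
      exact ⟨e.symm ⟨m, x, hm⟩, by simpa using hm, by simp⟩
    · rintro ⟨i, hi, rfl⟩
      exact hi
  rw [mem_ofPred_eq, mem_ofPred_eq, himage]
  exact infinite_image_iff (f := fun i => (e i : ℕ))
    (Subtype.val_injective.comp e.injective).injOn

end PointFinite

/-! ### Fubini products of ideals -/

section Ideals

variable {Z W : Type*}

theorem IsAdmissibleIdeal.infinite_of_notMem {J : Set (Set W)} (hJ : IsAdmissibleIdeal J)
    {S : Set W} (hS : S ∉ J) : S.Infinite :=
  fun h => hS (hJ.finite_mem S h)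

theorem isAdmissibleIdeal_finIdeal [Infinite Z] : IsAdmissibleIdeal (finIdeal Z) where
  subset_mem _ _ h hT := Set.Finite.subset hT h
  union_mem _ _ hS hT := Set.Finite.union hS hT
  finite_mem _ hS := hS
  univ_notMem := infinite_univ

/-- The first factor need not contain the singletons, so that `{∅}` is allowed. -/
theorem IsAdmissibleIdeal.fubiniProd {I : Set (Set Z)} {J : Set (Set W)}
    (hJ : IsAdmissibleIdeal J) (hsub : ∀ S T : Set Z, S ⊆ T → T ∈ I → S ∈ I)
    (hunion : ∀ S T : Set Z, S ∈ I → T ∈ I → S ∪ T ∈ I) (hempty : ∅ ∈ I)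
    (huniv : (univ : Set Z) ∉ I) : IsAdmissibleIdeal (fubiniProd I J) where
  subset_mem S T h hT :=
    hsub _ _ (fun n hn hTn => hn (hJ.subset_mem _ _ (fun k hk => h hk) hTn)) hT
  union_mem S T hS hT := by
    refine hsub _ _ (fun n hn => ?_) (hunion _ _ hS hT)
    by_contra h
    have h1 : {k | (n, k) ∈ S} ∈ J := by
      by_contra h1
      exact h (Or.inl h1)
    have h2 : {k | (n, k) ∈ T} ∈ J := by
      by_contra h2
      exact h (Or.inr h2)
    exact hn (hJ.union_mem _ _ h1 h2)
  finite_mem S hS := by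
    refine hsub _ _ (fun n hn => ?_) hempty
    exact hn (hJ.finite_mem _ (hS.preimage (Prod.mk_right_injective n).injOn))
  univ_notMem h := by
    refine huniv (hsub _ _ (fun n _ => ?_) h)
    exact hJ.univ_notMem

theorem isAdmissibleIdeal_finPow (a : ℕ) : IsAdmissibleIdeal (finPow (a + 1)) := by
  induction a with
  | zero => exact isAdmissibleIdeal_finIdeal
  | succ a ih =>
    have h := isAdmissibleIdeal_finIdeal (Z := ℕ)
    exact ih.fubiniProd h.subset_mem h.union_mem (h.finite_mem _ finite_empty) h.univ_notMem

theorem isAdmissibleIdeal_emptyTimesFinPow (a : ℕ) :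
    IsAdmissibleIdeal (emptyTimesFinPow (a + 1)) := by
  refine (isAdmissibleIdeal_finPow a).fubiniProd ?_ ?_ rfl ?_
  · rintro S _ h rfl
    exact subset_empty_iff.1 h
  · rintro _ _ rfl rfl
    exact union_self _
  · exact fun h => empty_ne_univ (mem_singleton_iff.1 h).symm

/-! ### Borel complexity of the ideals -/

theorem mem_finIdeal_nat {S : Set ℕ} : S ∈ finIdeal ℕ ↔ ∃ n, ∀ k ≥ n, k ∉ S := by
  constructor
  · intro h
    obtain ⟨n, hn⟩ := Set.Finite.bddAbove h
    exact ⟨n + 1, fun k hk hkS => absurd (hn hkS) (by omega)⟩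
  · rintro ⟨n, hn⟩
    refine (finite_Iio n).subset fun k hk => ?_
    by_contra h
    exact hn k (not_lt.1 h) hk

theorem continuous_section (n : ℕ) :
    Continuous fun (χ : ℕ × W → Bool) (k : W) => χ (n, k) :=
  continuous_pi fun _ => continuous_apply _

theorem asCantorSubset_finIdeal_mem : asCantorSubset (finIdeal ℕ) ∈ SigmaZero (ℕ → Bool) 2 := by
  refine ⟨fun n => ⋂ k, {χ : ℕ → Bool | χ (n + k) = false}, fun n => ?_, ?_⟩
  · have h : IsClosed (⋂ k, {χ : ℕ → Bool | χ (n + k) = false}) :=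
      isClosed_iInter fun k => isClosed_eq (continuous_apply (n + k)) continuous_const
    exact h.isOpen_compl
  · ext χ
    simp only [asCantorSubset, mem_ofPred_eq, mem_finIdeal_nat, mem_iUnion, mem_iInter]
    refine exists_congr fun n => ⟨fun h k => ?_, fun h k hk => ?_⟩
    · simpa using h (n + k) (Nat.le_add_right _ _)
    · obtain ⟨j, rfl⟩ := Nat.exists_eq_add_of_le hk
      simp [h j]

theorem asCantorSubset_fin_fubiniProd_mem {J : Set (Set W)} {n : ℕ}
    (hJ : asCantorSubset J ∈ SigmaZero (W → Bool) (n + 1)) :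
    asCantorSubset (fubiniProd (finIdeal ℕ) J) ∈ SigmaZero (ℕ × W → Bool) (n + 3) := by
  refine ⟨fun i => ⋂ k, (fun (χ : ℕ × W → Bool) (w : W) => χ (i + k, w)) ⁻¹' asCantorSubset J,
    fun i => ?_, ?_⟩
  · exact piZero_iInter fun k =>
      sigmaZero_subset_piZero_succ (sigmaZero_preimage (continuous_section _) hJ)
  · ext χ
    simp only [asCantorSubset, fubiniProd, mem_ofPred_eq, mem_finIdeal_nat, mem_iUnion, mem_iInter,
      mem_preimage, not_not]
    refine exists_congr fun i => ⟨fun h k => h (i + k) (Nat.le_add_right _ _), fun h k hk => ?_⟩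
    obtain ⟨j, rfl⟩ := Nat.exists_eq_add_of_le hk
    exact h j

theorem asCantorSubset_empty_fubiniProd_mem {J : Set (Set W)} {n : ℕ}
    (hJ : asCantorSubset J ∈ SigmaZero (W → Bool) (n + 1)) :
    asCantorSubset (fubiniProd ({∅} : Set (Set ℕ)) J) ∈ PiZero (ℕ × W → Bool) (n + 2) := by
  have h : asCantorSubset (fubiniProd ({∅} : Set (Set ℕ)) J) =
      ⋂ k, (fun (χ : ℕ × W → Bool) (w : W) => χ (k, w)) ⁻¹' asCantorSubset J := by
    ext χ
    simp [asCantorSubset, fubiniProd, eq_empty_iff_forall_notMem]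
  rw [h]
  exact piZero_iInter fun k =>
    sigmaZero_subset_piZero_succ (sigmaZero_preimage (continuous_section _) hJ)

theorem asCantorSubset_finPow_mem (a : ℕ) :
    asCantorSubset (finPow (a + 1)) ∈ SigmaZero (OmegaPow (a + 1) → Bool) (2 * a + 2) := by
  induction a with
  | zero => exact asCantorSubset_finIdeal_mem
  | succ a ih => exact asCantorSubset_fin_fubiniProd_mem ih

end Ideals

/-! ### Limit points along Fubini products -/

section LimitPoints

theorem finite_section {X W : Type*} {x : ℕ × W → X} {S : Set (ℕ × W)} {V : Set X}
    (h : {z ∈ S | x z ∉ V}.Finite) (n : ℕ) :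
    {w ∈ {w | (n, w) ∈ S} | x (n, w) ∉ V}.Finite :=
  h.preimage (f := Prod.mk n) (Prod.mk_right_injective n).injOn

variable {X : Type*} [TopologicalSpace X] {Z W : Type*}

theorem tendsto_cofinite_inf_principal_nhds {x : Z → X} {S : Set Z} {η : X} :
    Tendsto x (cofinite ⊓ 𝓟 S) (𝓝 η) ↔ ∀ V ∈ 𝓝 η, {z ∈ S | x z ∉ V}.Finite := by
  refine forall₂_congr fun V _ => ?_
  rw [mem_map, mem_inf_principal, mem_cofinite]
  refine iff_of_eq (congrArg _ ?_)
  ext z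
  simp

theorem mem_idealLimitPoints {J : Set (Set W)} (hJ : IsAdmissibleIdeal J) {x : W → X} {η : X} :
    η ∈ idealLimitPoints J x ↔ ∃ S ∉ J, ∀ V ∈ 𝓝 η, {z ∈ S | x z ∉ V}.Finite := by
  constructor
  · rintro ⟨S, -, hS, h⟩
    exact ⟨S, hS, tendsto_cofinite_inf_principal_nhds.1 h⟩
  · rintro ⟨S, hS, h⟩
    exact ⟨S, hJ.infinite_of_notMem hS, hS, tendsto_cofinite_inf_principal_nhds.2 h⟩

/-- A limit point along `Fin × J` is a point which is a limit point along `J` of infinitely many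
vertical sections of the sequence. Given witnesses on the sections, thin out the `n`-th one so that
it stays in the `n`-th basic neighbourhood; only finitely many points are lost in each section. -/
theorem idealLimitPoints_fin_fubiniProd [FirstCountableTopology X] {J : Set (Set W)}
    (hJ : IsAdmissibleIdeal J) (hfJ : IsAdmissibleIdeal (fubiniProd (finIdeal ℕ) J))
    (x : ℕ × W → X) :
    idealLimitPoints (fubiniProd (finIdeal ℕ) J) x =
      {η | {n | η ∈ idealLimitPoints J fun w => x (n, w)}.Infinite} := by
  ext η
  rw [mem_idealLimitPoints hfJ, mem_ofPred_eq]
  constructor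
  · rintro ⟨S, hS, h⟩
    refine Infinite.mono (fun n hn => ?_) hS
    exact (mem_idealLimitPoints hJ).2 ⟨_, hn, fun V hV => finite_section (h V hV) n⟩
  · intro hinf
    obtain ⟨U, hU⟩ := (𝓝 η).exists_antitone_basis
    have hex : ∀ n, ∃ S : Set W, η ∈ idealLimitPoints J (fun w => x (n, w)) →
        S ∉ J ∧ ∀ V ∈ 𝓝 η, {w ∈ S | x (n, w) ∉ V}.Finite := by
      intro n
      by_cases hn : η ∈ idealLimitPoints J (fun w => x (n, w))
      · obtain ⟨S, hS⟩ := (mem_idealLimitPoints hJ).1 hn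
        exact ⟨S, fun _ => hS⟩
      · exact ⟨∅, fun h => absurd h hn⟩
    choose S hS using hex
    refine ⟨{z | η ∈ idealLimitPoints J (fun w => x (z.1, w)) ∧ z.2 ∈ S z.1 ∧ x z ∈ U z.1},
      fun hmem => hinf (Set.Finite.subset hmem fun n hn hmemJ => ?_), fun V hV => ?_⟩
    · refine (hS n hn).1 (hJ.subset_mem _ _ (fun w hw => ?_) (hJ.union_mem _ _ hmemJ
        (hJ.finite_mem _ ((hS n hn).2 (U n) (hU.1.mem_of_mem trivial)))))
      by_cases hwU : x (n, w) ∈ U n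
      · exact Or.inl ⟨hn, hw, hwU⟩
      · exact Or.inr ⟨hw, hwU⟩
    · obtain ⟨m, -, hm⟩ := hU.1.mem_iff.1 hV
      have hfin : ∀ n, {z : ℕ × W | z.1 = n ∧ η ∈ idealLimitPoints J (fun w => x (n, w)) ∧
          z.2 ∈ S n ∧ x z ∉ V}.Finite := by
        intro n
        by_cases hn : η ∈ idealLimitPoints J (fun w => x (n, w))
        · refine (((hS n hn).2 V hV).image (Prod.mk n)).subset ?_
          rintro ⟨_, w⟩ ⟨rfl, -, h⟩
          exact ⟨w, h, rfl⟩
        · convert finite_empty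
          ext z
          simp [hn]
      refine ((finite_Iio m).biUnion fun n _ => hfin n).subset ?_
      rintro ⟨n, w⟩ ⟨⟨h1, h2, h3⟩, h4⟩
      refine mem_biUnion (x := n) ?_ ⟨rfl, h1, h2, h4⟩
      by_contra hnm
      exact h4 (hm (hU.2 (not_lt.1 hnm) h3))

theorem idealLimitPoints_empty_fubiniProd {J : Set (Set W)}
    (hJ : IsAdmissibleIdeal J) (hfJ : IsAdmissibleIdeal (fubiniProd ({∅} : Set (Set ℕ)) J))
    (x : ℕ × W → X) :
    idealLimitPoints (fubiniProd ({∅} : Set (Set ℕ)) J) x =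
      ⋃ n, idealLimitPoints J fun w => x (n, w) := by
  ext η
  rw [mem_idealLimitPoints hfJ, mem_iUnion]
  constructor
  · rintro ⟨S, hS, h⟩
    obtain ⟨n, hn⟩ := nonempty_iff_ne_empty.2 hS
    exact ⟨n, (mem_idealLimitPoints hJ).2
      ⟨_, hn, fun V hV => finite_section (h V hV) n⟩⟩
  · rintro ⟨n, hn⟩
    obtain ⟨S, hS, h⟩ := (mem_idealLimitPoints hJ).1 hn
    refine ⟨Prod.mk n '' S, fun hmem => ?_, fun V hV => ?_⟩
    · have hmem' : n ∉ {m | {k | (m, k) ∈ Prod.mk n '' S} ∉ J} := by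
        rw [show {m | {k | (m, k) ∈ Prod.mk n '' S} ∉ J} = ∅ from hmem]
        exact notMem_empty n
      exact hmem' (by simpa using hS)
    · refine ((h V hV).image (Prod.mk n)).subset ?_
      rintro _ ⟨⟨w, hw, rfl⟩, hV⟩
      exact ⟨w, ⟨hw, hV⟩, rfl⟩

theorem idealLimitPoints_finIdeal [FirstCountableTopology X] (x : ℕ → X) :
    idealLimitPoints (finIdeal ℕ) x = {η | MapClusterPt η atTop x} := by
  ext η
  constructor
  · rintro ⟨S, hS, -, h⟩
    have := cofinite_inf_principal_neBot_iff.2 hS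
    refine (h.mapClusterPt).mono ?_
    rw [Nat.cofinite_eq_atTop]
    exact inf_le_left
  · intro h
    obtain ⟨ψ, hψ, hlim⟩ := MapClusterPt.tendsto_subseq h
    have hinf : (range ψ).Infinite := infinite_range_of_injective hψ.injective
    refine (mem_idealLimitPoints isAdmissibleIdeal_finIdeal).2 ⟨range ψ, hinf, fun V hV => ?_⟩
    have hfin : {k | x (ψ k) ∉ V}.Finite := by
      have := hlim hV
      rwa [← Nat.cofinite_eq_atTop, mem_map, mem_cofinite] at this
    refine (hfin.image ψ).subset ?_
    rintro _ ⟨⟨k, rfl⟩, hk⟩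
    exact ⟨k, hk, rfl⟩

/-- Every nonempty closed set of a second countable space is the set of cluster points of a
sequence running infinitely often through each point of a countable dense subset of it. -/
theorem exists_idealLimitPoints_finIdeal_eq [SecondCountableTopology X] {C : Set X}
    (hC : IsClosed C) (hne : C.Nonempty) : ∃ x : ℕ → X, idealLimitPoints (finIdeal ℕ) x = C := by
  have := hne.to_subtype
  obtain ⟨y, hy⟩ := TopologicalSpace.exists_dense_seq C
  refine ⟨fun m => y m.unpair.1, ?_⟩
  rw [idealLimitPoints_finIdeal]
  ext η
  constructor
  · intro h
    by_contra hη
    obtain ⟨m, hm⟩ := (h.frequently (hC.isOpen_compl.mem_nhds hη)).exists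
    exact hm (y _).2
  · intro hη
    refine mapClusterPt_iff_frequently.2 fun V hV => ?_
    obtain ⟨i, hi⟩ := hy.exists_mem_open (isOpen_interior.preimage continuous_subtype_val)
      ⟨⟨η, hη⟩, mem_interior_iff_mem_nhds.2 hV⟩
    refine frequently_atTop.2 fun k => ⟨Nat.pair i k, Nat.right_le_pair i k, ?_⟩
    simpa using interior_subset hi

theorem idealLimitPoints_emptyTimesFinPow (a : ℕ) (x : ℕ × OmegaPow (a + 1) → X) :
    idealLimitPoints (emptyTimesFinPow (a + 1)) x =
      ⋃ n, idealLimitPoints (finPow (a + 1)) fun w => x (n, w) :=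
  idealLimitPoints_empty_fubiniProd (isAdmissibleIdeal_finPow a)
    (isAdmissibleIdeal_emptyTimesFinPow a) x

variable [TopologicalSpace.MetrizableSpace X]

theorem idealLimitPoints_finPow_succ (a : ℕ) (x : OmegaPow (a + 2) → X) :
    idealLimitPoints (finPow (a + 2)) x =
      {η | {n : ℕ | η ∈ idealLimitPoints (finPow (a + 1)) fun w => x (n, w)}.Infinite} :=
  idealLimitPoints_fin_fubiniProd (isAdmissibleIdeal_finPow a) (isAdmissibleIdeal_finPow (a + 1)) x

theorem idealLimitPoints_finPow_mem (a : ℕ) (x : OmegaPow (a + 1) → X) :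
    idealLimitPoints (finPow (a + 1)) x ∈ PiZero X (2 * a + 1) := by
  induction a with
  | zero =>
    refine mem_piZero_one.2 ?_
    have h : IsClosed {η | MapClusterPt η atTop (x : ℕ → X)} := isClosed_setOfPred_clusterPt
    rwa [← idealLimitPoints_finIdeal] at h
  | succ a ih =>
    rw [idealLimitPoints_finPow_succ]
    exact limsup_mem_piZero fun n => ih _

theorem exists_idealLimitPoints_finPow_eq [SecondCountableTopology X] (a : ℕ) {A : Set X}
    (hA : A ∈ PiZero X (2 * a + 1)) (hne : A.Nonempty) :
    ∃ x : OmegaPow (a + 1) → X, idealLimitPoints (finPow (a + 1)) x = A := by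
  induction a generalizing A with
  | zero => exact exists_idealLimitPoints_finIdeal_eq (mem_piZero_one.1 hA) hne
  | succ a ih =>
    obtain ⟨C, hC, hCne, rfl⟩ := exists_limsup_of_mem_piZero (n := 2 * a) hA hne
    choose x hx using fun i => ih (hC i) (hCne i)
    refine ⟨fun z : ℕ × OmegaPow (a + 1) => x z.1 z.2, ?_⟩
    rw [idealLimitPoints_finPow_succ]
    simp only [hx]

theorem empty_mem_sigmaZero_and_piZero (n : ℕ) :
    (∅ : Set X) ∈ SigmaZero X (n + 1) ∧ (∅ : Set X) ∈ PiZero X (n + 1) :=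
  ⟨sigmaZero_mono le_rfl (by omega) (mem_sigmaZero_one.2 isOpen_empty),
    sigmaZero_mono le_rfl (by omega) (mem_sigmaZero_one.2 isClosed_empty.isOpen_compl)⟩

theorem limitFamily_finPow [SecondCountableTopology X] (a : ℕ) :
    limitFamily X (finPow (a + 1)) = PiZero X (2 * a + 1) := by
  ext A
  constructor
  · rintro (⟨x, rfl⟩ | rfl)
    · exact idealLimitPoints_finPow_mem a x
    · exact (empty_mem_sigmaZero_and_piZero _).2
  · intro hA
    obtain rfl | hne := A.eq_empty_or_nonempty
    · exact Or.inr rfl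
    · obtain ⟨x, hx⟩ := exists_idealLimitPoints_finPow_eq a hA hne
      exact Or.inl ⟨x, hx.symm⟩

theorem limitFamily_emptyTimesFinPow [SecondCountableTopology X] (a : ℕ) :
    limitFamily X (emptyTimesFinPow (a + 1)) = SigmaZero X (2 * a + 2) := by
  ext A
  constructor
  · rintro (⟨x, rfl⟩ | rfl)
    · rw [idealLimitPoints_emptyTimesFinPow]
      exact ⟨_, fun n => idealLimitPoints_finPow_mem a _, rfl⟩
    · exact (empty_mem_sigmaZero_and_piZero _).1
  · intro hA
    obtain rfl | ⟨η, hη⟩ := A.eq_empty_or_nonempty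
    · exact Or.inr rfl
    · obtain ⟨B, hB, rfl⟩ := hA
      obtain ⟨i₀, hi₀⟩ := mem_iUnion.1 hη
      -- an empty `B n` need not be realizable, so it is replaced by the nonempty `B i₀`
      have hex : ∀ n, ∃ x : OmegaPow (a + 1) → X,
          B n ⊆ idealLimitPoints (finPow (a + 1)) x ∧
            idealLimitPoints (finPow (a + 1)) x ⊆ ⋃ i, B i := by
        intro n
        obtain hn | hn := (B n).eq_empty_or_nonempty
        · obtain ⟨x, hx⟩ := exists_idealLimitPoints_finPow_eq a (hB i₀) ⟨η, hi₀⟩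
          exact ⟨x, by simp [hn], hx.subset.trans (subset_iUnion B i₀)⟩
        · obtain ⟨x, hx⟩ := exists_idealLimitPoints_finPow_eq a (hB n) hn
          exact ⟨x, hx.superset, hx.subset.trans (subset_iUnion B n)⟩
      choose x hx hx' using hex
      refine Or.inl ⟨fun z => x z.1 z.2, ?_⟩
      rw [idealLimitPoints_emptyTimesFinPow]
      exact (iUnion_mono hx).antisymm (iUnion_subset hx')

end LimitPoints

/-! ### Universal sets and proper inclusions of the Borel classes -/

section Universal

/-- A `Σ⁰ₙ₊₁` subset of `{0,1}^ω × Y` is universal if every `Σ⁰ₙ₊₁` subset of `Y` is one of its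
sections. The step splits a code `p` into countably many codes by means of a pairing function. -/
theorem exists_universal_sigmaZero (Y : Type*) [TopologicalSpace Y] [SecondCountableTopology Y]
    (n : ℕ) : ∃ U ∈ SigmaZero ((ℕ → Bool) × Y) (n + 1),
      ∀ A ∈ SigmaZero Y (n + 1), ∃ p : ℕ → Bool, A = {y | (p, y) ∈ U} := by
  induction n with
  | zero =>
    obtain ⟨b, hbc, -, hb⟩ := TopologicalSpace.exists_countable_basis Y
    have hne : (insert ∅ b).Nonempty := insert_nonempty _ _
    obtain ⟨V, hV⟩ := (hbc.insert ∅).exists_eq_range hne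
    have hVo : ∀ i, IsOpen (V i) := by
      intro i
      have hi : V i ∈ insert ∅ b := hV ▸ mem_range_self i
      rcases hi with h | h
      · rw [h]
        exact isOpen_empty
      · exact hb.isOpen h
    refine ⟨⋃ i, {q | q.1 i = true} ∩ {q | q.2 ∈ V i}, ?_, fun A hA => ?_⟩
    · refine mem_sigmaZero_one.2 (isOpen_iUnion fun i => IsOpen.inter ?_ ?_)
      · exact (isOpen_discrete ({true} : Set Bool)).preimage
          (f := fun q : (ℕ → Bool) × Y => q.1 i) ((continuous_apply i).comp continuous_fst)
      · exact (hVo i).preimage continuous_snd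
    · classical
      refine ⟨fun i => decide (V i ⊆ A), ?_⟩
      ext y
      simp only [mem_ofPred_eq, mem_iUnion, mem_inter_iff, decide_eq_true_eq]
      constructor
      · intro hy
        obtain ⟨v, hv, hyv, hvA⟩ := hb.exists_subset_of_mem_open hy (mem_sigmaZero_one.1 hA)
        obtain ⟨i, rfl⟩ : v ∈ range V := hV ▸ mem_insert_of_mem _ hv
        exact ⟨i, hvA, hyv⟩
      · rintro ⟨i, hi, hy⟩
        exact hi hy
  | succ n ih =>
    obtain ⟨U, hU, huniv⟩ := ih
    let f : ℕ → (ℕ → Bool) × Y → (ℕ → Bool) × Y := fun i q => (fun k => q.1 (Nat.pair i k), q.2)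
    have hf : ∀ i, Continuous (f i) := fun i =>
      (continuous_pi fun k => (continuous_apply _).comp continuous_fst).prodMk continuous_snd
    refine ⟨⋃ i, (f i) ⁻¹' Uᶜ, ⟨fun i => (f i) ⁻¹' Uᶜ, fun i => ?_, rfl⟩, ?_⟩
    · exact piZero_preimage (hf i) (compl_mem_piZero.2 hU)
    · rintro A ⟨B, hB, rfl⟩
      choose p hp using fun i => huniv _ (hB i)
      refine ⟨fun m => p m.unpair.1 m.unpair.2, ?_⟩
      ext y
      simp only [mem_iUnion, mem_ofPred_eq, mem_preimage]
      refine exists_congr fun i => ?_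
      have hpi : y ∈ (B i)ᶜ ↔ (p i, y) ∈ U := by
        rw [hp i]
        exact Iff.rfl
      rw [← not_iff_not, ← mem_compl_iff, hpi]
      simp [f]

/-- Diagonalization against a universal set. -/
theorem exists_piZero_notMem_sigmaZero_cantor (n : ℕ) :
    ∃ D ∈ PiZero (ℕ → Bool) (n + 1), D ∉ SigmaZero (ℕ → Bool) (n + 1) := by
  obtain ⟨U, hU, huniv⟩ := exists_universal_sigmaZero (ℕ → Bool) n
  refine ⟨(fun y => (y, y)) ⁻¹' Uᶜ, ?_, fun hD => ?_⟩
  · exact piZero_preimage (continuous_id.prodMk continuous_id) (compl_mem_piZero.2 hU)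
  · obtain ⟨p, hp⟩ := huniv _ hD
    have h : p ∈ (fun y => (y, y)) ⁻¹' Uᶜ ↔ (p, p) ∈ U := by
      rw [hp]
      exact Iff.rfl
    exact iff_not_self h.symm

theorem piZero_image {X Y : Type*} [TopologicalSpace X] [TopologicalSpace Y]
    [TopologicalSpace.MetrizableSpace Y] {f : X → Y}
    (hf : IsClosedEmbedding f) {n : ℕ} {A : Set X} (hA : A ∈ PiZero X (n + 1)) :
    f '' A ∈ PiZero Y (n + 1) := by
  induction n generalizing A with
  | zero => exact mem_piZero_one.2 (hf.isClosedMap _ (mem_piZero_one.1 hA))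
  | succ n ih =>
    obtain ⟨B, hB, hAB⟩ := hA
    have h : f '' A = range f ∩ ⋂ i, (f '' B i)ᶜ := by
      rw [← compl_compl A, hAB, image_compl_eq_range_sdiff_image hf.injective, image_iUnion,
        sdiff_eq, compl_iUnion]
    have hrange : range f ∈ PiZero Y (n + 2) :=
      sigmaZero_mono le_rfl (by omega) (mem_sigmaZero_one.2 hf.isClosed_range.isOpen_compl)
    rw [h]
    exact piZero_inter hrange
      (piZero_iInter fun i => sigmaZero_subset_piZero_succ (ih (hB i)))

/-- The Borel hierarchy of an uncountable Polish space does not collapse at a finite level: move a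
counterexample from the Cantor space along a closed embedding. -/
theorem exists_piZero_notMem_sigmaZero (X : Type*) [TopologicalSpace X] [PolishSpace X]
    [Uncountable X] (n : ℕ) : ∃ A ∈ PiZero X (n + 1), A ∉ SigmaZero X (n + 1) := by
  obtain ⟨f, -, hfc, hfi⟩ :=
    (isClosed_univ (X := X)).exists_nat_bool_injection_of_not_countable not_countable_univ
  have hf : IsClosedEmbedding f := hfc.isClosedEmbedding hfi
  obtain ⟨D, hD, hDn⟩ := exists_piZero_notMem_sigmaZero_cantor n
  refine ⟨f '' D, piZero_image hf hD, fun h => hDn ?_⟩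
  rw [← preimage_image_eq D hfi]
  exact sigmaZero_preimage hfc h

end Universal

theorem mainTheorem1 (X : Type*) [TopologicalSpace X]
    [TopologicalSpace.IsCompletelyMetrizableSpace X] [TopologicalSpace.SeparableSpace X] :
    (∀ α : ℕ, 1 ≤ α →
      (IsAdmissibleIdeal (finPow α) ∧
        asCantorSubset (finPow α) ∈ SigmaZero (OmegaPow α → Bool) (2 * α) ∧
        limitFamily X (finPow α) = PiZero X (2 * α - 1)) ∧
      (IsAdmissibleIdeal (emptyTimesFinPow α) ∧
        asCantorSubset (emptyTimesFinPow α) ∈ PiZero (ℕ × OmegaPow α → Bool) (2 * α + 1) ∧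
        limitFamily X (emptyTimesFinPow α) = SigmaZero X (2 * α))) ∧
    (Uncountable X → ∀ n : ℕ, 1 ≤ n → ∃ α : ℕ, 1 ≤ α ∧
      (∃ A ∈ limitFamily X (finPow α), A ∉ SigmaZero X n ∧ A ∉ PiZero X n) ∧
      (∃ A ∈ limitFamily X (emptyTimesFinPow α), A ∉ SigmaZero X n ∧ A ∉ PiZero X n)) := by
  constructor
  · intro α hα
    obtain ⟨a, rfl⟩ : ∃ a, α = a + 1 := ⟨α - 1, by omega⟩
    exact ⟨⟨isAdmissibleIdeal_finPow a, asCantorSubset_finPow_mem a, limitFamily_finPow a⟩,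
      isAdmissibleIdeal_emptyTimesFinPow a,
      asCantorSubset_empty_fubiniProd_mem (n := 2 * a + 1) (asCantorSubset_finPow_mem a),
      limitFamily_emptyTimesFinPow a⟩
  · intro _ n hn
    -- with `α = n + 1`, the classes `Π⁰` of level `2n + 1` and `Σ⁰` of level `2n + 2` lie above
    -- level `n`, and `Σ⁰ₙ`, `Π⁰ₙ` are contained in both classes of each such level
    have hSS : ∀ m, n < m → SigmaZero X n ⊆ SigmaZero X m := fun m h => sigmaZero_mono hn h.le
    have hPS : ∀ m, n < m → PiZero X n ⊆ SigmaZero X m := by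
      obtain ⟨k, rfl⟩ : ∃ k, n = k + 1 := ⟨n - 1, by omega⟩
      exact fun m h => piZero_subset_sigmaZero_succ.trans (sigmaZero_mono (by omega) h)
    refine ⟨n + 1, by omega, ?_, ?_⟩
    · obtain ⟨A, hA, hAn⟩ := exists_piZero_notMem_sigmaZero X (2 * n)
      rw [limitFamily_finPow]
      exact ⟨A, hA, fun h => hAn (hSS _ (by omega) h), fun h => hAn (hPS _ (by omega) h)⟩
    · obtain ⟨A, hA, hAn⟩ := exists_piZero_notMem_sigmaZero X (2 * n + 1)
      rw [limitFamily_emptyTimesFinPow]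
      refine ⟨Aᶜ, hA, fun h => hAn (hPS _ (by omega) ?_), fun h => hAn (hSS _ (by omega) ?_)⟩
      · exact h
      · rwa [PiZero, mem_ofPred_eq, compl_compl] at h
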